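/- Let $\alpha,\beta>-1$, $c>0$ and $t_0\ge 1$ be real. For $n\in\mathbb Z_+=\{0,1,2,\dots\}$ let $$P_n^{(\alpha,\beta)}(x)=\binom{n+\alpha}{n}\,{}_2F_1\Big(-n,\,n+\alpha+\beta+1;\,\alpha+1;\,\tfrac{1-x}{2}\Big)$$ be the Jacobi polynomials and let $$\widehat P_0^{(\alpha,\beta)}(x)=\frac{1}{\sqrt{2^{\alpha+\beta+1}\,\mathrm B(\alpha+1,\beta+1)}},\qquad \widehat P_n^{(\alpha,\beta)}(x)=\sqrt{\frac{(2n+\alpha+\beta+1)\,n!\,\Gamma(n+\alpha+\beta+1)}{2^{\alpha+\beta+1}\,\Gamma(n+\alpha+1)\,\Gamma(n+\beta+1)}}\;P_n^{(\alpha,\beta)}(x)\quad(n\ge 1)$$ be the corresponding orthonormal polynomials for the weight $(1-x)^\alpha(1+x)^\beta$ on $[-1,1]$. For real $a,b,d$ put $$D_{a,b,d}:=(x^2-1)\frac{d^2}{dx^2}+\big[(a+b+2)x+a-b\big]\frac{d}{dx}+d,\qquad l^{(a,b)}_{n,d}:=d+n(n+a+b+1),$$ and define $$P_n(\alpha,\beta,c,t_0;x):=\sum_{k=0}^n\frac{1}{l^{(\alpha,\beta)}_{k,c}}\,\widehat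 P_k^{(\alpha,\beta)}(t_0)\,\widehat P_k^{(\alpha,\beta)}(x),\qquad n\in\mathbb Z_+.$$ Then the polynomials $P_n(x)=P_n(\alpha,\beta,c,t_0;x)$ are Sobolev orthogonal polynomials: $\deg P_n=n$ for all $n\in\mathbb Z_+$, and there are positive numbers $A_n$ such that for all $n,m\in\mathbb Z_+$ the following integral converges absolutely and $$\int_{-1}^1\big(P_n(x),P_n'(x),P_n''(x)\big)\,M_{\alpha,\beta,c}(x)\begin{pmatrix}P_m(x)\\P_m'(x)\\P_m''(x)\end{pmatrix}(t_0-x)(1-x)^\alpha(1+x)^\beta\,dx=A_n\,\delta_{n,m},$$ where $$M_{\alpha,\beta,c}(x)=\begin{pmatrix}c\\(\alpha+\beta+2)x+\alpha-\beta\\x^2-1\end{pmatrix}\big(c,\ (\alpha+\beta+2)x+\alpha-\beta,\ x^2-1\big).$$ Moreover, for $t_0=1$ the following differential equation of fourth order holds for every $n\in\mathbb Z_+$: $$D_{\alpha+1,\beta,0}\,D_{\alpha,\beta,c}\,P_n(\alpha,\beta,c,1;x)=l^{(\alpha+1,\beta)}_{n,0}\,D_{\alpha,\beta,c}\,P_n(\alpha,\beta,c,1;x),\qquad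 l^{(\alpha+1,\beta)}_{n,0}=n(n+\alpha+\beta+2).$$ -/

import Mathlib

noncomputable section

namespace JacobiSobolev

open Polynomial Finset MeasureTheory

/-- The Jacobi polynomial `P_n^{(α,β)}`: the terminating series
`binom (n+α) n * ₂F₁(-n, n+α+β+1; α+1; (1-x)/2)`, whose terms with index `k > n` vanish.
`(ascPochhammer ℝ k).eval a` is the shifted factorial `(a)_k = a (a+1) ⋯ (a+k-1)`. -/
def jacobi (α β : ℝ) (n : ℕ) : ℝ[X] :=
  C (Ring.choose ((n : ℝ) + α) n) *
    ∑ k ∈ range (n + 1),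
      C ((ascPochhammer ℝ k).eval (-(n : ℝ)) * (ascPochhammer ℝ k).eval ((n : ℝ) + α + β + 1) /
          ((ascPochhammer ℝ k).eval (α + 1) * (k.factorial : ℝ))) *
        (C (1 / 2) * (1 - X)) ^ k

/-- The orthonormal Jacobi polynomial for the weight `(1-x)^α (1+x)^β` on `[-1,1]`. -/
def jacobiHat (α β : ℝ) (n : ℕ) : ℝ[X] :=
  if n = 0 then
    C (1 / √((2 : ℝ) ^ (α + β + 1) * ProbabilityTheory.beta (α + 1) (β + 1)))
  else
    C √(((2 * n + α + β + 1) * (n.factorial : ℝ) * Real.Gamma (n + α + β + 1)) /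
        ((2 : ℝ) ^ (α + β + 1) * Real.Gamma (n + α + 1) * Real.Gamma (n + β + 1))) *
      jacobi α β n

/-- The differential operator
`D_{α,β,c} = (x²-1) d²/dx² + [(α+β+2) x + α - β] d/dx + c` acting on polynomials. -/
def diffOp (α β c : ℝ) (p : ℝ[X]) : ℝ[X] :=
  (X ^ 2 - 1) * derivative (derivative p) + (C (α + β + 2) * X + C (α - β)) * derivative p + C c * p

/-- `l_{n,c} = c + n (n + α + β + 1)`, with its dependence on `α, β` made explicit. -/
def eig (α β c : ℝ) (n : ℕ) : ℝ :=
  c + n * (n + α + β + 1)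

/-- The modified kernel polynomial `P_n(α,β,c,t₀;x)`. -/
def modKernel (α β c t₀ : ℝ) (n : ℕ) : ℝ[X] :=
  ∑ k ∈ range (n + 1), C (1 / eig α β c k * (jacobiHat α β k).eval t₀) * jacobiHat α β k

/-- The vector of coefficients of `D_{α,β,c}` at `x`, in increasing order of differentiation. -/
def coeffVec (α β c x : ℝ) : Fin 3 → ℝ :=
  ![c, (α + β + 2) * x + α - β, x ^ 2 - 1]

/-- The rank-one matrix `M_{α,β,c}(x)`: column `coeffVec` times row `coeffVec`. -/
def sobolevMatrix (α β c x : ℝ) : Matrix (Fin 3) (Fin 3) ℝ :=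
  Matrix.vecMulVec (coeffVec α β c x) (coeffVec α β c x)

/-- The vector `(p(x), p'(x), p''(x))`. -/
def jet (p : ℝ[X]) (x : ℝ) : Fin 3 → ℝ :=
  ![p.eval x, (derivative p).eval x, (derivative (derivative p)).eval x]

/-- The integrand of the Sobolev inner product of `p` and `q`. -/
def sobolevIntegrand (α β c t₀ : ℝ) (p q : ℝ[X]) (x : ℝ) : ℝ :=
  (jet p x ⬝ᵥ (Matrix.mulVec (sobolevMatrix α β c x) (jet q x))) *
    ((t₀ - x) * (1 - x) ^ α * (1 + x) ^ β)

end JacobiSobolev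

end

noncomputable section

namespace JacobiSobolev

open Polynomial Finset MeasureTheory

/-! ### Algebraic properties of the Jacobi polynomials -/

/-! The matrix `M` has rank one, so the Sobolev integrand is `(D p)(D q)(t₀ - x)` times the Jacobi
weight, where `D = D_{α,β,c}`. Jacobi polynomials are eigenfunctions of `D` with eigenvalues
`l_{k,c} > 0`, and the modified kernel divides by exactly these; hence `D P_n` is the ordinary
kernel polynomial `K_n` at `t₀` (`diffOp_modKernel`).

Everything then rests on the reproducing property `∫ K_n q w = q(t₀)` for `deg q ≤ n`
(`moment_kernel_mul`). With `q = (t₀ - x) r` and `deg r < n` it shows that `K_n` is orthogonal to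
lower degrees for the weight `(t₀ - x) w`, which is positive on `(-1,1)` since `t₀ ≥ 1`. The degree
claim holds because Jacobi polynomials are positive at `t₀ ≥ 1`.

For `t₀ = 1` the new weight is the Jacobi weight with `α + 1`, so orthogonality and symmetry of
`D_{α+1,β,0}` make `K_n` an eigenfunction.

The reproducing property needs the stated constants to give norm one; this is proved by induction on
`n`, raising both parameters through the derivative formula. -/

lemma ascPochhammer_eval_succ_left (a : ℝ) (k : ℕ) :
    (ascPochhammer ℝ (k + 1)).eval a = a * (ascPochhammer ℝ k).eval (a + 1) := by
  simp [ascPochhammer_succ_left]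

lemma choose_add_eq (α : ℝ) (n : ℕ) :
    Ring.choose ((n : ℝ) + α) n = (ascPochhammer ℝ n).eval (α + 1) / n.factorial := by
  have h := Ring.factorial_nsmul_multichoose_eq_ascPochhammer (α + 1) n
  rw [ascPochhammer_smeval_eq_eval, nsmul_eq_mul] at h
  rw [eq_div_iff (by positivity), ← h, mul_comm, Ring.choose]
  congr 2
  ring

/-- The coefficient of `((1-x)/2)^k` in `₂F₁(-n, n+α+β+1; α+1; (1-x)/2)`. -/
def hypCoeff (α β : ℝ) (n k : ℕ) : ℝ :=
  (ascPochhammer ℝ k).eval (-(n : ℝ)) * (ascPochhammer ℝ k).eval ((n : ℝ) + α + β + 1) /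
    ((ascPochhammer ℝ k).eval (α + 1) * (k.factorial : ℝ))

lemma jacobi_eq (α β : ℝ) (n : ℕ) :
    jacobi α β n = C ((ascPochhammer ℝ n).eval (α + 1) / n.factorial) *
      ∑ k ∈ range (n + 1), C (hypCoeff α β n k) * (C (1 / 2) * (1 - X)) ^ k := by
  rw [jacobi, choose_add_eq]
  rfl

@[simp]
lemma jacobi_zero (α β : ℝ) : jacobi α β 0 = 1 := by
  simp [jacobi_eq, hypCoeff]

/-- The factor `(k - n)(k + n + α + β + 1)` is the difference of the eigenvalues with indices `k`
and `n`; this recurrence is the eigenvalue equation read coefficientwise. -/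
lemma hypCoeff_succ {α : ℝ} (hα : -1 < α) (β : ℝ) (n k : ℕ) :
    (k + 1) * (k + 1 + α) * hypCoeff α β n (k + 1) =
      (k - n) * (k + n + α + β + 1) * hypCoeff α β n k := by
  have h1 : (ascPochhammer ℝ k).eval (α + 1) ≠ 0 :=
    (ascPochhammer_pos k (α + 1) (by linarith)).ne'
  have h2 : α + 1 + k ≠ 0 := by
    have : (0 : ℝ) ≤ k := k.cast_nonneg
    linarith
  have h3 : (k.factorial : ℝ) ≠ 0 := by positivity
  have h4 : (k : ℝ) + 1 ≠ 0 := by positivity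
  simp only [hypCoeff, ascPochhammer_succ_eval, Nat.factorial_succ, Nat.cast_mul, Nat.cast_add,
    Nat.cast_one]
  field_simp
  ring

lemma hypCoeff_eq_zero (α β : ℝ) (n : ℕ) : hypCoeff α β n (n + 1) = 0 := by
  simp [hypCoeff, ascPochhammer_succ_eval]

lemma hypCoeff_succ_succ {α : ℝ} (hα : -1 < α) (β : ℝ) (n k : ℕ) :
    (k + 1) * (α + 1) * hypCoeff α β (n + 1) (k + 1) =
      -((n + 1) * (n + α + β + 2)) * hypCoeff (α + 1) (β + 1) n k := by
  have h1 : (ascPochhammer ℝ k).eval (α + 1 + 1) ≠ 0 :=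
    (ascPochhammer_pos k (α + 1 + 1) (by linarith)).ne'
  have h2 : α + 1 ≠ 0 := by linarith
  have h3 : (k.factorial : ℝ) ≠ 0 := by positivity
  have h4 : (k : ℝ) + 1 ≠ 0 := by positivity
  simp only [hypCoeff, ascPochhammer_eval_succ_left, Nat.factorial_succ, Nat.cast_mul, Nat.cast_add,
    Nat.cast_one]
  rw [show -((n : ℝ) + 1) + 1 = -n by ring, show (n : ℝ) + 1 + α + β + 1 + 1 =
    n + (α + 1) + (β + 1) + 1 by ring]
  field_simp
  ring

lemma derivative_half_one_sub_pow (k : ℕ) :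
    derivative ((C (1 / 2 : ℝ) * (1 - X)) ^ k) =
      C (-(k : ℝ) / 2) * (C (1 / 2 : ℝ) * (1 - X)) ^ (k - 1) := by
  rw [derivative_pow]
  simp only [derivative_mul, derivative_C, derivative_sub, derivative_one, derivative_X]
  rw [show -(k : ℝ) / 2 = k * -(1 / 2) by ring, C_mul, C_neg]
  simp only [map_natCast]
  ring

/-- Lowering the degree while raising both parameters drives the inductions for leading
coefficients, values on `[1, ∞)` and norms. -/
lemma derivative_jacobi_succ {α : ℝ} (hα : -1 < α) (β : ℝ) (n : ℕ) :
    derivative (jacobi α β (n + 1)) =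
      C ((n + α + β + 2) / 2) * jacobi (α + 1) (β + 1) n := by
  rw [jacobi_eq, jacobi_eq, derivative_C_mul, derivative_sum, sum_range_succ' _ (n + 1),
    mul_left_comm, mul_sum, mul_add, mul_sum, mul_sum]
  simp only [pow_zero, mul_one, derivative_C, mul_zero, add_zero]
  refine sum_congr rfl fun k _ => ?_
  rw [derivative_C_mul, derivative_half_one_sub_pow, Nat.add_sub_cancel, ← mul_assoc, ← mul_assoc,
    ← mul_assoc, ← mul_assoc, ← C_mul, ← C_mul, ← C_mul, ← C_mul]
  congr 2
  have h := hypCoeff_succ_succ hα β n k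
  have h2 : α + 1 ≠ 0 := by linarith
  have h3 : (n.factorial : ℝ) ≠ 0 := by positivity
  have h4 : (n : ℝ) + 1 ≠ 0 := by positivity
  rw [ascPochhammer_eval_succ_left, Nat.factorial_succ]
  push_cast
  rw [← sub_eq_zero] at h ⊢
  field_simp
  linear_combination (-(ascPochhammer ℝ n).eval (α + 1 + 1)) * h

lemma eval_one_jacobi (α β : ℝ) (n : ℕ) :
    (jacobi α β n).eval 1 = (ascPochhammer ℝ n).eval (α + 1) / n.factorial := by
  rw [jacobi_eq, eval_mul, eval_C, eval_finsetSum, sum_range_succ']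
  simp [hypCoeff]

lemma natDegree_jacobi_le (α β : ℝ) (n : ℕ) : (jacobi α β n).natDegree ≤ n := by
  rw [jacobi_eq]
  refine (natDegree_C_mul_le _ _).trans (natDegree_sum_le_of_forall_le _ _ fun k hk => ?_)
  refine (natDegree_C_mul_le _ _).trans (natDegree_pow_le.trans ?_)
  have h : (C (1 / 2 : ℝ) * (1 - X)).natDegree ≤ 1 := by
    compute_degree
  have := mem_range.1 hk
  nlinarith

lemma coeff_jacobi_pos {α β : ℝ} (hα : -1 < α) (hβ : -1 < β) (n : ℕ) :
    0 < (jacobi α β n).coeff n := by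
  induction n generalizing α β with
  | zero => simp
  | succ n ih =>
    have h := congrArg (fun p => coeff p n) (derivative_jacobi_succ hα β n)
    simp only [coeff_derivative, coeff_C_mul] at h
    have h1 := ih (α := α + 1) (β := β + 1) (by linarith) (by linarith)
    have h2 : 0 < (n + α + β + 2) / 2 := by
      have : (0 : ℝ) ≤ n := n.cast_nonneg
      linarith
    have h3 := mul_pos h2 h1
    rw [← h] at h3
    exact pos_of_mul_pos_left h3 (by positivity)

/-- The value at `1` is explicit and positive, and by induction the derivative is positive to the
right of `1`, so no information on zeros is needed. -/
lemma eval_jacobi_pos {α β : ℝ} (hα : -1 < α) (hβ : -1 < β) (n : ℕ) {t : ℝ} (ht : 1 ≤ t) :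
    0 < (jacobi α β n).eval t := by
  induction n generalizing α β t with
  | zero => simp
  | succ n ih =>
    have hmono : MonotoneOn (fun x => (jacobi α β (n + 1)).eval x) (Set.Ici 1) := by
      refine monotoneOn_of_deriv_nonneg (convex_Ici 1) (Polynomial.continuousOn _)
        (Polynomial.differentiable _).differentiableOn fun x hx => ?_
      rw [interior_Ici] at hx
      rw [Polynomial.deriv, derivative_jacobi_succ hα, eval_mul, eval_C]
      have h1 := ih (α := α + 1) (β := β + 1) (by linarith) (by linarith) (le_of_lt hx)
      have h2 : 0 < (n + α + β + 2) / 2 := by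
        have : (0 : ℝ) ≤ n := n.cast_nonneg
        linarith
      positivity
    refine lt_of_lt_of_le ?_ (hmono (Set.self_mem_Ici) ht ht)
    simp only [eval_one_jacobi]
    have := ascPochhammer_pos (n + 1) (α + 1) (by linarith)
    positivity

lemma eig_pos {α β c : ℝ} (hα : -1 < α) (hβ : -1 < β) (hc : 0 < c) (n : ℕ) :
    0 < eig α β c n := by
  rw [eig]
  rcases n with _ | n
  · simpa using hc
  · have : (0 : ℝ) ≤ n := n.cast_nonneg
    have h : 0 < ((n + 1 : ℕ) : ℝ) + α + β + 1 := by push_cast; linarith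
    positivity

lemma eig_injective {α β : ℝ} (hα : -1 < α) (hβ : -1 < β) (c : ℝ) :
    Function.Injective (eig α β c) := by
  intro n m h
  by_contra hne
  have h0 : ((n : ℝ) - m) * (n + m + α + β + 1) = 0 := by
    simp only [eig] at h
    linear_combination h
  have h1 : (n : ℝ) - m ≠ 0 := sub_ne_zero.2 (Nat.cast_injective.ne hne)
  have h2 : (1 : ℝ) ≤ n + m := by
    have : 1 ≤ n + m := by omega
    exact_mod_cast this
  exact mul_ne_zero h1 (by linarith) h0

/-! ### The differential operator -/

lemma diffOp_C_mul (a b d r : ℝ) (p : ℝ[X]) :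
    diffOp a b d (C r * p) = C r * diffOp a b d p := by
  simp only [diffOp, derivative_C_mul]
  ring

lemma diffOp_sum {ι : Type*} (a b d : ℝ) (s : Finset ι) (f : ι → ℝ[X]) :
    diffOp a b d (∑ i ∈ s, f i) = ∑ i ∈ s, diffOp a b d (f i) := by
  simp only [diffOp, derivative_sum, mul_sum, sum_add_distrib]

/-- The operator is triangular on monomials with the eigenvalues on the diagonal, so it never raises
degrees. -/
lemma coeff_diffOp (a b d : ℝ) (p : ℝ[X]) (k : ℕ) :
    (diffOp a b d p).coeff k = eig a b d k * p.coeff k + (a - b) * (k + 1) * p.coeff (k + 1) -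
      (k + 2) * (k + 1) * p.coeff (k + 2) := by
  have h : diffOp a b d p = X * (X * derivative (derivative p)) - derivative (derivative p) +
      (C (a + b + 2) * (X * derivative p) + C (a - b) * derivative p) + C d * p := by
    rw [diffOp]
    ring
  rw [h]
  rcases k with _ | _ | k
  · simp [coeff_derivative, eig]
    ring
  · simp only [coeff_add, coeff_sub, coeff_X_mul, coeff_C_mul, coeff_derivative, eig,
      coeff_X_mul_zero]
    push_cast
    ring
  · simp only [coeff_add, coeff_sub, coeff_X_mul, coeff_C_mul, coeff_derivative, eig]
    push_cast
    ring

lemma degree_diffOp_lt {p : ℝ[X]} {n : ℕ} (hp : p.degree < n) (a b d : ℝ) :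
    (diffOp a b d p).degree < n := by
  rw [degree_lt_iff_coeff_zero] at hp ⊢
  intro k hk
  rw [coeff_diffOp, hp k hk, hp (k + 1) (by omega), hp (k + 2) (by omega)]
  ring

/-- In powers of `(1 - x)/2` the operator has only two terms. The truncated exponent at `k = 0` is
harmless, as its coefficient vanishes. -/
lemma diffOp_half_one_sub_pow (α β c : ℝ) (k : ℕ) :
    diffOp α β c ((C (1 / 2) * (1 - X)) ^ k) =
      C (eig α β c k) * (C (1 / 2) * (1 - X)) ^ k -
        C (k * (k + α)) * (C (1 / 2) * (1 - X)) ^ (k - 1) := by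
  rcases k with _ | k
  · simp [diffOp, eig]
  rw [diffOp, derivative_half_one_sub_pow, derivative_C_mul, derivative_half_one_sub_pow]
  refine Polynomial.funext fun x => ?_
  rcases k with _ | k
  · simp [eig]
    ring
  · simp only [eig, eval_add, eval_sub, eval_mul, eval_pow, eval_C, eval_X, eval_one,
      Nat.add_sub_cancel]
    push_cast
    ring

lemma diffOp_jacobi {α : ℝ} (hα : -1 < α) (β c : ℝ) (n : ℕ) :
    diffOp α β c (jacobi α β n) = C (eig α β c n) * jacobi α β n := by
  rw [jacobi_eq, diffOp_C_mul, mul_left_comm, diffOp_sum]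
  congr 1
  simp only [diffOp_C_mul, diffOp_half_one_sub_pow]
  simp only [mul_sub (C (hypCoeff _ _ _ _))]
  rw [sum_sub_distrib, sum_range_succ' (fun k => C (hypCoeff α β n k) * (C (_ : ℝ) * _ ^ (k - 1)))]
  -- The index shift loses the top term; it can be restored because the series terminates.
  have h : ∑ k ∈ range n, C (hypCoeff α β n (k + 1)) * (C (((k + 1 : ℕ) : ℝ) * ((k + 1 : ℕ) + α)) *
      (C (1 / 2 : ℝ) * (1 - X)) ^ (k + 1 - 1)) = ∑ k ∈ range (n + 1), C (hypCoeff α β n (k + 1)) *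
      (C (((k + 1 : ℕ) : ℝ) * ((k + 1 : ℕ) + α)) * (C (1 / 2 : ℝ) * (1 - X)) ^ k) := by
    rw [sum_range_succ _ n, hypCoeff_eq_zero]
    simp
  rw [h]
  simp only [Nat.cast_zero, zero_mul, map_zero, mul_zero, add_zero]
  rw [← sum_sub_distrib, mul_sum]
  refine sum_congr rfl fun k _ => ?_
  simp only [← mul_assoc, ← C_mul]
  rw [← sub_mul, ← C_sub]
  congr 2
  have := hypCoeff_succ hα β n k
  simp only [eig]
  push_cast
  linear_combination -this

/-! ### The Jacobi weight and its moment functional -/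

/-- The weight `(1-x)^α (1+x)^β`. -/
def weight (α β x : ℝ) : ℝ := (1 - x) ^ α * (1 + x) ^ β

lemma weight_pos (α β : ℝ) {x : ℝ} (hx : x ∈ Set.Ioo (-1 : ℝ) 1) : 0 < weight α β x :=
  mul_pos (Real.rpow_pos_of_pos (by linarith [hx.2]) _)
    (Real.rpow_pos_of_pos (by linarith [hx.1]) _)

lemma weight_add_one (α β : ℝ) {x : ℝ} (hx : x ∈ Set.Ioo (-1 : ℝ) 1) :
    weight (α + 1) β x = (1 - x) * weight α β x := by
  rw [weight, weight, Real.rpow_add_one (by linarith [hx.2])]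
  ring

lemma weight_add_one_add_one (α β : ℝ) {x : ℝ} (hx : x ∈ Set.Ioo (-1 : ℝ) 1) :
    weight (α + 1) (β + 1) x = (1 - x ^ 2) * weight α β x := by
  rw [weight, weight, Real.rpow_add_one (by linarith [hx.2]), Real.rpow_add_one (by linarith [hx.1])]
  ring

lemma intervalIntegrable_weight {α β : ℝ} (hα : -1 < α) (hβ : -1 < β) :
    IntervalIntegrable (weight α β) volume (-1) 1 := by
  have h1 : IntervalIntegrable (weight α β) volume (-1) 0 := by
    have h : IntervalIntegrable (fun x : ℝ => (1 + x) ^ β) volume (-1) 0 := by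
      have := (intervalIntegral.intervalIntegrable_rpow' (a := 0) (b := 1) hβ).comp_add_left 1
      simpa using this
    refine h.continuousOn_mul (ContinuousOn.rpow_const (by fun_prop) fun x hx => Or.inl ?_)
    rw [Set.uIcc_of_le (by norm_num)] at hx
    linarith [hx.2]
  have h2 : IntervalIntegrable (weight α β) volume 0 1 := by
    have h : IntervalIntegrable (fun x : ℝ => (1 - x) ^ α) volume 0 1 := by
      have := (intervalIntegral.intervalIntegrable_rpow' (a := 0) (b := 1) hα).comp_sub_left 1
      simpa using this.symm
    refine h.mul_continuousOn (ContinuousOn.rpow_const (by fun_prop) fun x hx => Or.inl ?_)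
    rw [Set.uIcc_of_le (by norm_num)] at hx
    linarith [hx.1]
  exact h1.trans h2

lemma intervalIntegrable_eval_mul_weight {α β : ℝ} (hα : -1 < α) (hβ : -1 < β) (p : ℝ[X]) :
    IntervalIntegrable (fun x => p.eval x * weight α β x) volume (-1) 1 :=
  (intervalIntegrable_weight hα hβ).continuousOn_mul p.continuousOn

/-- The moment functional `p ↦ ∫_{-1}^1 p(x) (1-x)^α (1+x)^β dx`. -/
def moment (α β : ℝ) (p : ℝ[X]) : ℝ := ∫ x in (-1 : ℝ)..1, p.eval x * weight α β x

lemma integral_congr_Ioo {f g : ℝ → ℝ} (h : ∀ x ∈ Set.Ioo (-1 : ℝ) 1, f x = g x) :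
    ∫ x in (-1 : ℝ)..1, f x = ∫ x in (-1 : ℝ)..1, g x := by
  rw [intervalIntegral.integral_of_le (by norm_num), intervalIntegral.integral_of_le (by norm_num),
    integral_Ioc_eq_integral_Ioo, integral_Ioc_eq_integral_Ioo]
  exact setIntegral_congr_fun measurableSet_Ioo h

lemma moment_C_mul (α β r : ℝ) (p : ℝ[X]) : moment α β (C r * p) = r * moment α β p := by
  simp only [moment, eval_mul, eval_C, mul_assoc, intervalIntegral.integral_const_mul]

lemma moment_zero (α β : ℝ) : moment α β 0 = 0 := by
  simp [moment]

lemma moment_add {α β : ℝ} (hα : -1 < α) (hβ : -1 < β) (p q : ℝ[X]) :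
    moment α β (p + q) = moment α β p + moment α β q := by
  simp only [moment]
  rw [← intervalIntegral.integral_add (intervalIntegrable_eval_mul_weight hα hβ p)
    (intervalIntegrable_eval_mul_weight hα hβ q)]
  simp only [eval_add, add_mul]

lemma moment_sub {α β : ℝ} (hα : -1 < α) (hβ : -1 < β) (p q : ℝ[X]) :
    moment α β (p - q) = moment α β p - moment α β q := by
  simp only [moment]
  rw [← intervalIntegral.integral_sub (intervalIntegrable_eval_mul_weight hα hβ p)
    (intervalIntegrable_eval_mul_weight hα hβ q)]
  simp only [eval_sub, sub_mul]

lemma moment_sum {α β : ℝ} (hα : -1 < α) (hβ : -1 < β) {ι : Type*} (s : Finset ι) (f : ι → ℝ[X]) :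
    moment α β (∑ i ∈ s, f i) = ∑ i ∈ s, moment α β (f i) := by
  classical
  induction s using Finset.induction_on with
  | empty => simp [moment_zero]
  | insert i s hi ih => rw [sum_insert hi, sum_insert hi, moment_add hα hβ, ih]

/-- The integrand is nonzero on `(-1,1)` away from the finitely many roots. -/
lemma moment_pos {α β : ℝ} (hα : -1 < α) (hβ : -1 < β) {p : ℝ[X]} (hp : p ≠ 0)
    (h : ∀ x ∈ Set.Ioo (-1 : ℝ) 1, 0 ≤ p.eval x) :
    0 < moment α β p := by
  have hae : ∀ᵐ x ∂(volume.restrict (Set.uIoc (-1 : ℝ) 1)), x ∈ Set.Ioo (-1 : ℝ) 1 := by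
    rw [Set.uIoc_of_le (by norm_num), ← restrict_Ioo_eq_restrict_Ioc]
    exact ae_restrict_mem measurableSet_Ioo
  rw [moment, intervalIntegral.integral_pos_iff_support_of_nonneg_ae' _
    (intervalIntegrable_eval_mul_weight hα hβ p)]
  · refine ⟨by norm_num, ?_⟩
    have hsub : Set.Ioo (-1 : ℝ) 1 \ (p.roots.toFinset : Set ℝ) ⊆
        Function.support (fun x => p.eval x * weight α β x) ∩ Set.Ioc (-1) 1 := by
      rintro x ⟨hx, hr⟩
      refine ⟨mul_ne_zero (fun h0 => hr ?_) (weight_pos α β hx).ne', Set.Ioo_subset_Ioc_self hx⟩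
      simpa [hp] using h0
    refine lt_of_lt_of_le ?_ (measure_mono hsub)
    rw [measure_sdiff_null (Finset.measure_zero _ _)]
    simp
  · filter_upwards [hae] with x hx
    exact mul_nonneg (h x hx) (weight_pos α β hx).le

/-- The integral of the derivative of `(1-x)^(α+1) (1+x)^(β+1) r(x)` vanishes. -/
lemma moment_pearson {α β : ℝ} (hα : -1 < α) (hβ : -1 < β) (r : ℝ[X]) :
    moment α β ((1 - X ^ 2) * derivative r - (C (α + β + 2) * X + C (α - β)) * r) = 0 := by
  have h := intervalIntegral.integral_eq_sub_of_hasDerivAt_of_le (a := -1) (b := 1)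
    (f := fun x => weight (α + 1) (β + 1) x * r.eval x) (by norm_num) ?_ ?_
    (intervalIntegrable_eval_mul_weight hα hβ
      ((1 - X ^ 2) * derivative r - (C (α + β + 2) * X + C (α - β)) * r))
  · rw [moment, h]
    -- Both boundary terms vanish because the exponents `α + 1` and `β + 1` are nonzero.
    simp [weight, Real.zero_rpow (by linarith : α + 1 ≠ 0),
      Real.zero_rpow (by linarith : β + 1 ≠ 0)]
  · refine ContinuousOn.mul (ContinuousOn.mul ?_ ?_) r.continuousOn
    · exact ContinuousOn.rpow_const (by fun_prop) fun x _ => Or.inr (by linarith)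
    · exact ContinuousOn.rpow_const (by fun_prop) fun x _ => Or.inr (by linarith)
  · intro x hx
    have hx1 : 1 - x ≠ 0 := by linarith [hx.2]
    have hx2 : 1 + x ≠ 0 := by linarith [hx.1]
    have d1 : HasDerivAt (fun y : ℝ => (1 - y) ^ (α + 1)) _ x :=
      ((hasDerivAt_id x).const_sub 1).rpow_const (Or.inl hx1)
    have d2 : HasDerivAt (fun y : ℝ => (1 + y) ^ (β + 1)) _ x :=
      ((hasDerivAt_id x).const_add 1).rpow_const (Or.inl hx2)
    refine ((d1.mul d2).mul (r.hasDerivAt x)).congr_deriv ?_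
    simp only [id, weight, Pi.mul_apply, add_sub_cancel_right, Real.rpow_add_one hx1,
      Real.rpow_add_one hx2,
      eval_add, eval_sub, eval_mul, eval_pow, eval_C, eval_X, eval_one]
    ring

/-- Integration by parts, with `r = p' q` in `moment_pearson`. The right side is symmetric in `p`
and `q`, whence self-adjointness. -/
lemma moment_diffOp_mul {α β : ℝ} (hα : -1 < α) (hβ : -1 < β) (c : ℝ) (p q : ℝ[X]) :
    moment α β (diffOp α β c p * q) =
      moment α β ((1 - X ^ 2) * (derivative p * derivative q)) + c * moment α β (p * q) := by
  have h := moment_pearson hα hβ (derivative p * q)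
  have key : diffOp α β c p * q = ((1 - X ^ 2) * (derivative p * derivative q) + C c * (p * q)) -
      ((1 - X ^ 2) * derivative (derivative p * q) -
        (C (α + β + 2) * X + C (α - β)) * (derivative p * q)) := by
    rw [diffOp, derivative_mul]
    ring
  rw [key, moment_sub hα hβ, h, moment_add hα hβ, moment_C_mul, sub_zero]

lemma moment_diffOp_comm {α β : ℝ} (hα : -1 < α) (hβ : -1 < β) (c : ℝ) (p q : ℝ[X]) :
    moment α β (diffOp α β c p * q) = moment α β (p * diffOp α β c q) := by
  rw [mul_comm p, moment_diffOp_mul hα hβ, moment_diffOp_mul hα hβ, mul_comm q,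
    mul_comm (derivative q)]

lemma moment_one_sub_mul (α β : ℝ) (p : ℝ[X]) :
    moment (α + 1) β p = moment α β ((1 - X) * p) :=
  integral_congr_Ioo fun x hx => by
    rw [weight_add_one α β hx]
    simp
    ring

lemma moment_one_sub_sq_mul (α β : ℝ) (p : ℝ[X]) :
    moment (α + 1) (β + 1) p = moment α β ((1 - X ^ 2) * p) :=
  integral_congr_Ioo fun x hx => by
    rw [weight_add_one_add_one α β hx]
    simp
    ring

lemma beta_eq_integral {a b : ℝ} (ha : 0 < a) (hb : 0 < b) :
    ProbabilityTheory.beta a b = ∫ x in (0 : ℝ)..1, x ^ (a - 1) * (1 - x) ^ (b - 1) := by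
  rw [ProbabilityTheory.beta_eq_betaIntegralReal a b ha hb, ← Complex.ofReal_re (∫ x in _.._, _),
    ← intervalIntegral.integral_ofReal, Complex.betaIntegral]
  congr 1
  refine intervalIntegral.integral_congr fun x hx => ?_
  rw [Set.uIcc_of_le zero_le_one] at hx
  simp only [Complex.ofReal_mul]
  rw [Complex.ofReal_cpow hx.1, Complex.ofReal_cpow (by linarith [hx.2])]
  push_cast
  rfl

lemma moment_one {α β : ℝ} (hα : -1 < α) (hβ : -1 < β) :
    moment α β 1 = 2 ^ (α + β + 1) * ProbabilityTheory.beta (α + 1) (β + 1) := by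
  -- The substitution `x = 1 - 2u` leads to the Beta integral.
  have h := intervalIntegral.smul_integral_comp_add_mul (a := 0) (b := 1) (weight α β) (-2) 1
  rw [mul_zero, add_zero, mul_one, show (1 : ℝ) + -2 = -1 by norm_num,
    intervalIntegral.integral_symm (-1) 1, intervalIntegral.integral_of_le zero_le_one] at h
  have h2 : ∀ u ∈ Set.Ioc (0 : ℝ) 1, weight α β (1 + -2 * u) =
      2 ^ (α + β) * (u ^ (α + 1 - 1) * (1 - u) ^ (β + 1 - 1)) := by
    rintro u ⟨hu0, hu1⟩
    rw [weight, show 1 - (1 + -2 * u) = 2 * u by ring, show 1 + (1 + -2 * u) = 2 * (1 - u) by ring,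
      Real.mul_rpow (by norm_num) hu0.le, Real.mul_rpow (by norm_num) (by linarith),
      Real.rpow_add (by norm_num), add_sub_cancel_right, add_sub_cancel_right]
    ring
  rw [setIntegral_congr_fun measurableSet_Ioc h2, integral_const_mul,
    ← intervalIntegral.integral_of_le zero_le_one,
    ← beta_eq_integral (by linarith) (by linarith)] at h
  simp only [moment, eval_one, one_mul]
  rw [Real.rpow_add_one (by norm_num)]
  simp only [smul_eq_mul] at h
  linarith

/-! ### Orthogonality and norms of the Jacobi polynomials -/

lemma moment_jacobi_mul_jacobi_of_ne {α β : ℝ} (hα : -1 < α) (hβ : -1 < β) {n m : ℕ} (h : n ≠ m) :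
    moment α β (jacobi α β n * jacobi α β m) = 0 := by
  have h1 := moment_diffOp_comm hα hβ 0 (jacobi α β n) (jacobi α β m)
  rw [diffOp_jacobi hα, diffOp_jacobi hα, mul_assoc, mul_left_comm (jacobi α β n),
    moment_C_mul, moment_C_mul, ← sub_eq_zero, ← sub_mul] at h1
  exact (mul_eq_zero.1 h1).resolve_left (sub_ne_zero.2 ((eig_injective hα hβ 0).ne h))

/-- The energy identity with `c = 0`: the extra `1 - x²` raises both parameters of the weight,
matching the derivative. One factor `n + α + β + 2` cancels. -/
lemma moment_jacobi_succ_sq {α β : ℝ} (hα : -1 < α) (hβ : -1 < β) (n : ℕ) :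
    4 * (n + 1) * moment α β (jacobi α β (n + 1) * jacobi α β (n + 1)) =
      (n + α + β + 2) * moment (α + 1) (β + 1)
        (jacobi (α + 1) (β + 1) n * jacobi (α + 1) (β + 1) n) := by
  have h := moment_diffOp_mul hα hβ 0 (jacobi α β (n + 1)) (jacobi α β (n + 1))
  have h0 : (n : ℝ) + α + β + 2 ≠ 0 := by
    have : (0 : ℝ) ≤ n := n.cast_nonneg
    linarith
  rw [zero_mul, add_zero, diffOp_jacobi hα, ← moment_one_sub_sq_mul, derivative_jacobi_succ hα,
    mul_assoc, mul_assoc, mul_left_comm (jacobi _ _ _), moment_C_mul, moment_C_mul, moment_C_mul,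
    eig] at h
  push_cast at h
  refine mul_left_cancel₀ h0 ?_
  linear_combination 4 * h

/-- The positivity hypothesis restricts only `n = 0`, where `α + β + 1` may be a pole of Gamma; this
is why the orthonormal polynomial of degree zero is defined separately. -/
lemma moment_jacobi_sq {α β : ℝ} (hα : -1 < α) (hβ : -1 < β) (n : ℕ) (h : 0 < n + α + β + 1) :
    (2 * n + α + β + 1) * n.factorial * Real.Gamma (n + α + β + 1) *
      moment α β (jacobi α β n * jacobi α β n) =
    2 ^ (α + β + 1) * Real.Gamma (n + α + 1) * Real.Gamma (n + β + 1) := by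
  induction n generalizing α β with
  | zero =>
    have h' : 0 < α + β + 1 := by simpa using h
    have hG := Real.Gamma_add_one h'.ne'
    have : Real.Gamma (α + β + 1 + 1) ≠ 0 := (Real.Gamma_pos_of_pos (by linarith)).ne'
    rw [jacobi_zero, mul_one, moment_one hα hβ, ProbabilityTheory.beta,
      show α + 1 + (β + 1) = α + β + 1 + 1 by ring]
    simp only [Nat.cast_zero, mul_zero, zero_add, Nat.factorial_zero, Nat.cast_one, mul_one]
    rw [← hG]
    field_simp
  | succ n ih =>
    have hn : (0 : ℝ) ≤ n := n.cast_nonneg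
    have h1 := ih (α := α + 1) (β := β + 1) (by linarith) (by linarith) (by linarith)
    have h2 := moment_jacobi_succ_sq hα hβ n
    have h3 := Real.Gamma_add_one (s := n + α + β + 2) (by linarith)
    have h4 : (2 : ℝ) ^ (α + 1 + (β + 1) + 1) = 4 * 2 ^ (α + β + 1) := by
      rw [show α + 1 + (β + 1) + 1 = α + β + 1 + 2 by ring, Real.rpow_add (by norm_num)]
      norm_num
      ring
    rw [h4, show (n : ℝ) + (α + 1) + (β + 1) + 1 = n + α + β + 2 + 1 by ring, h3,
      show (n : ℝ) + (α + 1) + 1 = n + 1 + α + 1 by ring,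
      show (n : ℝ) + (β + 1) + 1 = n + 1 + β + 1 by ring] at h1
    rw [Nat.factorial_succ]
    push_cast
    rw [show (n : ℝ) + 1 + α + β + 1 = n + α + β + 2 by ring]
    linear_combination h1 / 4 +
      (2 * n + α + β + 3) * n.factorial * Real.Gamma (n + α + β + 2) / 4 * h2

/-! ### The orthonormal Jacobi polynomials -/

lemma exists_jacobiHat_eq {α β : ℝ} (hα : -1 < α) (hβ : -1 < β) (n : ℕ) :
    ∃ κ : ℝ, 0 < κ ∧ jacobiHat α β n = C κ * jacobi α β n ∧
      κ ^ 2 * moment α β (jacobi α β n * jacobi α β n) = 1 := by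
  rcases Nat.eq_zero_or_pos n with rfl | hn
  · have hB : 0 < 2 ^ (α + β + 1) * ProbabilityTheory.beta (α + 1) (β + 1) :=
      mul_pos (by positivity) (ProbabilityTheory.beta_pos (by linarith) (by linarith))
    refine ⟨_, one_div_pos.2 (Real.sqrt_pos.2 hB), by simp [jacobiHat], ?_⟩
    rw [jacobi_zero, mul_one, moment_one hα hβ, div_pow, one_pow, Real.sq_sqrt hB.le]
    exact one_div_mul_cancel hB.ne'
  · have hn' : (1 : ℝ) ≤ n := by exact_mod_cast hn
    have h := moment_jacobi_sq hα hβ n (by linarith)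
    have g1 := Real.Gamma_pos_of_pos (s := n + α + β + 1) (by linarith)
    have g2 := Real.Gamma_pos_of_pos (s := n + α + 1) (by linarith)
    have g3 := Real.Gamma_pos_of_pos (s := n + β + 1) (by linarith)
    have g4 : 0 < 2 * n + α + β + 1 := by linarith
    have hk : 0 < ((2 * n + α + β + 1) * (n.factorial : ℝ) * Real.Gamma (n + α + β + 1)) /
        ((2 : ℝ) ^ (α + β + 1) * Real.Gamma (n + α + 1) * Real.Gamma (n + β + 1)) := by
      positivity
    refine ⟨_, Real.sqrt_pos.2 hk, by rw [jacobiHat, if_neg hn.ne'], ?_⟩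
    rw [Real.sq_sqrt hk.le, div_mul_eq_mul_div, h]
    exact div_self (by positivity)

lemma moment_jacobiHat_mul_jacobiHat {α β : ℝ} (hα : -1 < α) (hβ : -1 < β) (n m : ℕ) :
    moment α β (jacobiHat α β n * jacobiHat α β m) = if n = m then 1 else 0 := by
  obtain ⟨κ, -, hn, hκ⟩ := exists_jacobiHat_eq hα hβ n
  split_ifs with h
  · subst h
    rw [hn, mul_mul_mul_comm, ← C_mul, moment_C_mul, ← sq, hκ]
  · obtain ⟨κ', -, hm, -⟩ := exists_jacobiHat_eq hα hβ m
    rw [hn, hm, mul_mul_mul_comm, ← C_mul, moment_C_mul,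
      moment_jacobi_mul_jacobi_of_ne hα hβ h, mul_zero]

lemma natDegree_jacobiHat_le {α β : ℝ} (hα : -1 < α) (hβ : -1 < β) (n : ℕ) :
    (jacobiHat α β n).natDegree ≤ n := by
  obtain ⟨κ, -, h, -⟩ := exists_jacobiHat_eq hα hβ n
  rw [h]
  exact (natDegree_C_mul_le _ _).trans (natDegree_jacobi_le α β n)

lemma coeff_jacobiHat_pos {α β : ℝ} (hα : -1 < α) (hβ : -1 < β) (n : ℕ) :
    0 < (jacobiHat α β n).coeff n := by
  obtain ⟨κ, hκ, h, -⟩ := exists_jacobiHat_eq hα hβ n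
  rw [h, coeff_C_mul]
  exact mul_pos hκ (coeff_jacobi_pos hα hβ n)

lemma eval_jacobiHat_pos {α β : ℝ} (hα : -1 < α) (hβ : -1 < β) (n : ℕ) {t : ℝ} (ht : 1 ≤ t) :
    0 < (jacobiHat α β n).eval t := by
  obtain ⟨κ, hκ, h, -⟩ := exists_jacobiHat_eq hα hβ n
  rw [h, eval_mul, eval_C]
  exact mul_pos hκ (eval_jacobi_pos hα hβ n ht)

lemma diffOp_jacobiHat {α β : ℝ} (hα : -1 < α) (hβ : -1 < β) (c : ℝ) (n : ℕ) :
    diffOp α β c (jacobiHat α β n) = C (eig α β c n) * jacobiHat α β n := by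
  obtain ⟨κ, -, h, -⟩ := exists_jacobiHat_eq hα hβ n
  rw [h, diffOp_C_mul, diffOp_jacobi hα, mul_left_comm]

/-! ### Combinations of orthonormal polynomials and the reproducing kernel -/

lemma natDegree_sum_jacobiHat_le {α β : ℝ} (hα : -1 < α) (hβ : -1 < β) (n : ℕ) (a : ℕ → ℝ) :
    (∑ k ∈ range (n + 1), C (a k) * jacobiHat α β k).natDegree ≤ n :=
  natDegree_sum_le_of_forall_le _ _ fun k hk => (natDegree_C_mul_le _ _).trans
    ((natDegree_jacobiHat_le hα hβ k).trans (Nat.lt_succ_iff.1 (mem_range.1 hk)))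

lemma coeff_sum_jacobiHat {α β : ℝ} (hα : -1 < α) (hβ : -1 < β) (n : ℕ) (a : ℕ → ℝ) :
    (∑ k ∈ range (n + 1), C (a k) * jacobiHat α β k).coeff n =
      a n * (jacobiHat α β n).coeff n := by
  rw [sum_range_succ, coeff_add, coeff_C_mul, finsetSum_coeff, sum_eq_zero, zero_add]
  intro k hk
  rw [coeff_C_mul, coeff_eq_zero_of_natDegree_lt, mul_zero]
  exact (natDegree_jacobiHat_le hα hβ k).trans_lt (mem_range.1 hk)

/-- Subtracting the right multiple of the top polynomial removes the leading term. -/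
lemma exists_eq_sum_jacobiHat {α β : ℝ} (hα : -1 < α) (hβ : -1 < β) (n : ℕ) (q : ℝ[X])
    (hq : q.natDegree ≤ n) :
    ∃ a : ℕ → ℝ, q = ∑ k ∈ range (n + 1), C (a k) * jacobiHat α β k := by
  induction n generalizing q with
  | zero =>
    have h0 := coeff_jacobiHat_pos hα hβ 0
    refine ⟨fun _ => q.coeff 0 / (jacobiHat α β 0).coeff 0, ?_⟩
    rw [zero_add, sum_range_one, eq_C_of_natDegree_le_zero hq,
      eq_C_of_natDegree_le_zero (natDegree_jacobiHat_le hα hβ 0), ← C_mul]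
    simp [h0.ne']
  | succ n ih =>
    have h0 := coeff_jacobiHat_pos hα hβ (n + 1)
    set r := q.coeff (n + 1) / (jacobiHat α β (n + 1)).coeff (n + 1) with hr
    obtain ⟨a, ha⟩ := ih (q - C r * jacobiHat α β (n + 1)) (by
      rw [natDegree_le_iff_coeff_eq_zero]
      intro N hN
      rw [coeff_sub, coeff_C_mul]
      rcases Nat.lt_or_eq_of_le (Nat.succ_le_of_lt hN) with h | h
      · rw [coeff_eq_zero_of_natDegree_lt (hq.trans_lt h),
          coeff_eq_zero_of_natDegree_lt ((natDegree_jacobiHat_le hα hβ _).trans_lt h)]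
        simp
      · rw [← h, hr, Nat.succ_eq_add_one, div_mul_cancel₀ _ h0.ne', sub_self])
    refine ⟨fun k => if k = n + 1 then r else a k, ?_⟩
    beta_reduce
    rw [sum_range_succ, if_pos rfl, ← sub_eq_iff_eq_add, ha]
    refine sum_congr rfl fun k hk => ?_
    rw [if_neg (mem_range.1 hk).ne]

/-- The kernel polynomial `∑_{k ≤ n} p_k(t) p_k(x)` of the orthonormal Jacobi polynomials. -/
def kernel (α β t : ℝ) (n : ℕ) : ℝ[X] :=
  ∑ k ∈ range (n + 1), C ((jacobiHat α β k).eval t) * jacobiHat α β k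

lemma moment_kernel_mul {α β : ℝ} (hα : -1 < α) (hβ : -1 < β) (t : ℝ) {n : ℕ} {q : ℝ[X]}
    (hq : q.natDegree ≤ n) : moment α β (kernel α β t n * q) = q.eval t := by
  obtain ⟨a, rfl⟩ := exists_eq_sum_jacobiHat hα hβ n q hq
  rw [mul_sum, moment_sum hα hβ, eval_finsetSum]
  refine sum_congr rfl fun k hk => ?_
  rw [mul_left_comm, moment_C_mul, eval_mul, eval_C, kernel, sum_mul, moment_sum hα hβ,
    sum_eq_single k]
  · rw [mul_assoc, moment_C_mul, moment_jacobiHat_mul_jacobiHat hα hβ, if_pos rfl, mul_one]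
  · intro j _ hj
    rw [mul_assoc, moment_C_mul, moment_jacobiHat_mul_jacobiHat hα hβ, if_neg hj, mul_zero]
  · exact fun h => absurd hk h

/-! ### Modified kernels, and kernel orthogonality for the weight times `t - x` -/

lemma diffOp_modKernel {α β c : ℝ} (hα : -1 < α) (hβ : -1 < β) (hc : 0 < c) (t : ℝ) (n : ℕ) :
    diffOp α β c (modKernel α β c t n) = kernel α β t n := by
  rw [modKernel, diffOp_sum, kernel]
  refine sum_congr rfl fun k _ => ?_
  have := (eig_pos hα hβ hc k).ne'
  rw [diffOp_C_mul, diffOp_jacobiHat hα hβ, ← mul_assoc, ← C_mul]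
  congr 2
  field_simp

lemma degree_modKernel {α β c t : ℝ} (hα : -1 < α) (hβ : -1 < β) (hc : 0 < c) (ht : 1 ≤ t)
    (n : ℕ) : (modKernel α β c t n).degree = n := by
  refine degree_eq_of_le_of_coeff_ne_zero
    (natDegree_le_iff_degree_le.1 (natDegree_sum_jacobiHat_le hα hβ n _)) ?_
  rw [modKernel, coeff_sum_jacobiHat hα hβ]
  have h1 := eig_pos hα hβ hc n
  have h2 := eval_jacobiHat_pos hα hβ n ht
  have h3 := coeff_jacobiHat_pos hα hβ n
  positivity

lemma natDegree_kernel_le {α β : ℝ} (hα : -1 < α) (hβ : -1 < β) (t : ℝ) (n : ℕ) :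
    (kernel α β t n).natDegree ≤ n :=
  natDegree_sum_jacobiHat_le hα hβ n _

lemma kernel_ne_zero {α β t : ℝ} (hα : -1 < α) (hβ : -1 < β) (ht : 1 ≤ t) (n : ℕ) :
    kernel α β t n ≠ 0 := by
  intro h
  have h1 := coeff_sum_jacobiHat hα hβ n fun k => (jacobiHat α β k).eval t
  rw [← kernel, h, coeff_zero] at h1
  exact (mul_pos (eval_jacobiHat_pos hα hβ n ht) (coeff_jacobiHat_pos hα hβ n)).ne h1

/-- The polynomial `(t - x) q` has degree at most `n`, so the kernel reproduces its value at `t`,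
which is zero. -/
lemma moment_kernel_mul_sub_mul {α β : ℝ} (hα : -1 < α) (hβ : -1 < β) (t : ℝ) {n : ℕ} {q : ℝ[X]}
    (hq : q.degree < n) : moment α β (kernel α β t n * ((C t - X) * q)) = 0 := by
  rcases eq_or_ne q 0 with rfl | h0
  · simp [moment_zero]
  rw [moment_kernel_mul hα hβ]
  · simp
  · have h1 := (natDegree_lt_iff_degree_lt h0).2 hq
    have h2 : (C t - X).natDegree ≤ 1 := by compute_degree
    have := natDegree_mul_le (p := C t - X) (q := q)
    omega

lemma moment_kernel_mul_kernel_of_lt {α β : ℝ} (hα : -1 < α) (hβ : -1 < β) (t : ℝ) {n m : ℕ}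
    (h : m < n) :
    moment α β (kernel α β t n * ((C t - X) * kernel α β t m)) = 0 :=
  moment_kernel_mul_sub_mul hα hβ t
    ((natDegree_le_iff_degree_le.1 (natDegree_kernel_le hα hβ t m)).trans_lt (by exact_mod_cast h))

lemma moment_kernel_sq_pos {α β t : ℝ} (hα : -1 < α) (hβ : -1 < β) (ht : 1 ≤ t) (n : ℕ) :
    0 < moment α β (kernel α β t n * ((C t - X) * kernel α β t n)) := by
  have hX : C t - X ≠ 0 := by
    rw [sub_ne_zero]
    exact (X_ne_C t).symm
  have hK := kernel_ne_zero hα hβ ht n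
  refine moment_pos hα hβ (mul_ne_zero hK (mul_ne_zero hX hK)) fun x hx => ?_
  rw [eval_mul, eval_mul, mul_left_comm, eval_sub, eval_C, eval_X]
  exact mul_nonneg (by linarith [hx.2]) (mul_self_nonneg _)

/-- For `t = 1` the kernel polynomials are eigenfunctions of the operator with shifted parameter. -/
lemma diffOp_kernel_one {α β : ℝ} (hα : -1 < α) (hβ : -1 < β) (n : ℕ) :
    diffOp (α + 1) β 0 (kernel α β 1 n) = C (eig (α + 1) β 0 n) * kernel α β 1 n := by
  have hα' : -1 < α + 1 := by linarith
  have hdeg := natDegree_le_iff_coeff_eq_zero.1 (natDegree_kernel_le hα hβ 1 n)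
  have horth : ∀ q : ℝ[X], q.degree < n → moment (α + 1) β (kernel α β 1 n * q) = 0 := by
    intro q hq
    rw [moment_one_sub_mul, mul_left_comm]
    exact moment_kernel_mul_sub_mul hα hβ 1 hq
  -- The coefficients of `x^n` cancel in `E`, so `deg E < n`. Moving the operator onto the other
  -- factor leaves the kernel against degrees below `n`: `E` is orthogonal to itself, hence zero.
  set E := diffOp (α + 1) β 0 (kernel α β 1 n) - C (eig (α + 1) β 0 n) * kernel α β 1 n with hE
  have hEdeg : E.degree < n := by
    rw [degree_lt_iff_coeff_zero]
    intro k hk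
    rw [hE, coeff_sub, coeff_diffOp, coeff_C_mul, hdeg (k + 1) (by omega), hdeg (k + 2) (by omega)]
    rcases hk.eq_or_lt with rfl | hk
    · ring
    · rw [hdeg k hk]
      ring
  have hE0 : moment (α + 1) β (E * E) = 0 := by
    nth_rw 1 [hE]
    rw [sub_mul, moment_sub hα' hβ, moment_diffOp_comm hα' hβ,
      horth _ (degree_diffOp_lt hEdeg _ _ _), mul_assoc, moment_C_mul, horth _ hEdeg, mul_zero, sub_zero]
  by_contra hne
  have hE1 : E ≠ 0 := sub_ne_zero.2 hne
  refine (moment_pos hα' hβ (mul_ne_zero hE1 hE1) fun x _ => ?_).ne' hE0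
  rw [eval_mul]
  exact mul_self_nonneg _

lemma sobolevIntegrand_eq (α β c t : ℝ) (p q : ℝ[X]) :
    sobolevIntegrand α β c t p q = fun x =>
      (diffOp α β c p * ((C t - X) * diffOp α β c q)).eval x * weight α β x := by
  ext x
  simp only [sobolevIntegrand, sobolevMatrix, coeffVec, jet, diffOp, weight, dotProduct,
    Matrix.mulVec, Matrix.vecMulVec_apply, Fin.sum_univ_three, Matrix.cons_val, eval_add, eval_sub,
    eval_mul, eval_pow, eval_C, eval_X, eval_one]
  ring

end JacobiSobolev

end

theorem theorem2 (α β c t₀ : ℝ) (hα : -1 < α) (hβ : -1 < β) (hc : 0 < c) (ht₀ : 1 ≤ t₀) :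
    (∀ n : ℕ, (JacobiSobolev.modKernel α β c t₀ n).degree = n) ∧
    (∃ A : ℕ → ℝ, (∀ n, 0 < A n) ∧ ∀ n m : ℕ,
      IntervalIntegrable
        (JacobiSobolev.sobolevIntegrand α β c t₀
          (JacobiSobolev.modKernel α β c t₀ n) (JacobiSobolev.modKernel α β c t₀ m))
        MeasureTheory.volume (-1) 1 ∧
      ∫ x in (-1 : ℝ)..1, JacobiSobolev.sobolevIntegrand α β c t₀
          (JacobiSobolev.modKernel α β c t₀ n) (JacobiSobolev.modKernel α β c t₀ m) x
        = if n = m then A n else 0) ∧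
    (∀ n : ℕ,
      JacobiSobolev.diffOp (α + 1) β 0
          (JacobiSobolev.diffOp α β c (JacobiSobolev.modKernel α β c 1 n)) =
        Polynomial.C (JacobiSobolev.eig (α + 1) β 0 n) *
          JacobiSobolev.diffOp α β c (JacobiSobolev.modKernel α β c 1 n)) := by
  -- Unification with `moment_kernel_sq_pos` sets `A n` to the squared norm of the kernel for the
  -- weight times `t₀ - x`.
  refine ⟨JacobiSobolev.degree_modKernel hα hβ hc ht₀, ⟨_,
    JacobiSobolev.moment_kernel_sq_pos hα hβ ht₀, fun n m => ?_⟩, fun n => ?_⟩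
  · rw [JacobiSobolev.sobolevIntegrand_eq, JacobiSobolev.diffOp_modKernel hα hβ hc,
      JacobiSobolev.diffOp_modKernel hα hβ hc]
    refine ⟨JacobiSobolev.intervalIntegrable_eval_mul_weight hα hβ _, ?_⟩
    rw [← JacobiSobolev.moment]
    rcases lt_trichotomy n m with h | rfl | h
    -- The two kernels are swapped so that the one of higher degree comes first.
    · rw [if_neg h.ne, mul_left_comm, mul_comm (JacobiSobolev.kernel α β t₀ n), mul_left_comm]
      exact JacobiSobolev.moment_kernel_mul_kernel_of_lt hα hβ t₀ h
    · rw [if_pos rfl]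
    · rw [if_neg h.ne']
      exact JacobiSobolev.moment_kernel_mul_kernel_of_lt hα hβ t₀ h
  · rw [JacobiSobolev.diffOp_modKernel hα hβ hc]
    exact JacobiSobolev.diffOp_kernel_one hα hβ n
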